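/- Let $K$ be a field and $x_1<\cdots<x_n$ ordered variables. For a polynomial $F\in K[x_1,\ldots,x_n]$ let $\mathrm{cls}(F)$ be the largest $p$ such that $x_p$ occurs in $F$ ($0$ if $F$ is constant). For nonconstant $F$ let $\mathrm{lv}(F)=x_{\mathrm{cls}(F)}$ and let $\mathrm{ini}(F)$ be the leading coefficient of $F$ as a polynomial in $\mathrm{lv}(F)$. A polynomial $G$ is R-reduced with respect to a nonconstant $F$ if $\deg(G,\mathrm{lv}(F))<\deg(F,\mathrm{lv}(F))$. A *triangular set* is a finite nonempty list $[T_1,\ldots,T_r]$ with $0<\mathrm{cls}(T_1)<\cdots<\mathrm{cls}(T_r)$. An *ascending set* is either a list $[c]$ with $c\in K\setminus\{0\}$, or a triangular set in which every $T_j$ is R-reduced with respect to every $T_i$ with $i<j$. Let $\mathrm{prem}(G,F,x_k)$ be the pseudo-remainder of $G$ by $F$ in $x_k$ (with multiplier $I^{q}$, where $I$ is the leading coefficient of $F$ in $x_k$ and $q=\max(\deg(G,x_k)-\deg(F,x_k)+1,0)$) and $\mathrm{res}(F,G,x_k)$ the resultant. For $T=[T_1,\ldots,T_r]$ put $\mathrm{prem}(P,T)=\mathrm{prem}(\cdots\mathrm{prem}(P,T_r,\mathrm{lv}(T_r))\cdots,T_1,\mathrm{lv}(T_1))$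 and $\mathrm{res}(F,T)=\mathrm{res}(\cdots\mathrm{res}(F,T_r,\mathrm{lv}(T_r))\cdots,T_1,\mathrm{lv}(T_1))$. A triangular set $T$ is *regular* if $\mathrm{res}(\mathrm{ini}(T_j),[T_1,\ldots,T_{j-1}])\neq0$ for $2\le j\le r$. For nonzero polynomials write $F\prec G$ if $\mathrm{cls}(F)<\mathrm{cls}(G)$, or $\mathrm{cls}(F)=\mathrm{cls}(G)>0$ and $\deg(F,\mathrm{lv}(F))<\deg(G,\mathrm{lv}(G))$; write $F\sim G$ if neither $F\prec G$ nor $G\prec F$. An ascending set $A'=[A'_1,\ldots,A'_{r'}]$ has lower rank than $A=[A_1,\ldots,A_r]$ if either for some $j\le\min(r,r')$ one has $A_i\sim A'_i$ for $i<j$ and $A'_j\prec A_j$, or $r'>r$ and $A_i\sim A'_i$ for $i\le r$. A *Ritt characteristic set* of an ideal is an ascending set contained in it such that no ascending set contained in it has lower rank. Let $\mathbb P\subset K[x_1,\ldots,x_n]$ be a finite nonempty set of nonzero polynomials and let $\mathbb G$ be the reduced Gröbner basis of $\langle\mathbb P\rangle$ for the purely lexicographical order with $x_1<\cdots<x_n$.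 The *W-characteristic set* $\mathbb C$ of $\langle\mathbb P\rangle$ consists, for each $i\in\{0,\ldots,n\}$ such that $\mathbb G$ has an element of class $i$, of the element of class $i$ in $\mathbb G$ with the smallest leading monomial; it is listed by increasing leading monomial. For $0\le i\le n$ let $\mathbb C^{\langle0,\ldots,i\rangle}$ be the list of the elements of $\mathbb C$ that lie in $K[x_1,\ldots,x_i]$, and let $\langle\mathbb P\rangle^{\langle0,\ldots,i\rangle}=\langle\mathbb P\rangle\cap K[x_1,\ldots,x_i]$ be the elimination ideal. **Corollary.** For every $0\le i\le n$: if $\mathbb C^{\langle0,\ldots,i\rangle}=[C_1,\ldots,C_k]$ is regular (in particular a triangular set, so nonempty and without constants), then $$[C_1,\ \mathrm{prem}(C_2,[C_1]),\ \ldots,\ \mathrm{prem}(C_k,[C_1,\ldots,C_{k-1}])]$$ is a Ritt characteristic set of the elimination ideal $\langle\mathbb P\rangle^{\langle0,\ldots,i\rangle}$. -/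

import Mathlib

namespace WRitt

open MvPolynomial
open scoped MonomialOrder

noncomputable section

/-! Throughout, `MvPolynomial (Fin n) K` is the polynomial ring `K[x₁, …, xₙ]`; the variable `x_{j+1}`
is `X j` for `j : Fin n`, and the variables are ordered by `x₁ < ⋯ < xₙ`. -/

/-! ### Pseudo-division in one variable -/

section Univariate

variable {R : Type*} [CommRing R]

/-- `t` steps of pseudo-division by `f`: each step multiplies the dividend `r` by the leading
coefficient of `f` and cancels its coefficient in degree `deg f + t`, with `t` decreasing to `0`. -/
def pseudoRemAux (f : Polynomial R) : ℕ → Polynomial R → Polynomial R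
  | 0, r => r
  | t + 1, r => pseudoRemAux f t
      (Polynomial.C f.leadingCoeff * r
        - Polynomial.C (r.coeff (f.natDegree + t)) * Polynomial.X ^ t * f)

/-- The pseudo-remainder of `g` with respect to `f`, with multiplier
`lc(f) ^ max (deg g - deg f + 1, 0)` (truncated subtraction of natural numbers gives the maximum). -/
def pseudoRem (g f : Polynomial R) : Polynomial R :=
  pseudoRemAux f (g.natDegree + 1 - f.natDegree) g

theorem pseudoRemAux_spec (f : Polynomial R) (t : ℕ) (r : Polynomial R)
    (hr : ∀ j, f.natDegree + t ≤ j → r.coeff j = 0) :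
    (∃ q : Polynomial R,
      Polynomial.C (f.leadingCoeff ^ t) * r = q * f + pseudoRemAux f t r) ∧
    ∀ j, f.natDegree ≤ j → (pseudoRemAux f t r).coeff j = 0 := by
  induction t generalizing r with
  | zero => exact ⟨⟨0, by simp [pseudoRemAux]⟩, by simpa [pseudoRemAux] using hr⟩
  | succ t ih =>
    have key : ∀ j, f.natDegree + t ≤ j →
        (Polynomial.C f.leadingCoeff * r
          - Polynomial.C (r.coeff (f.natDegree + t)) * Polynomial.X ^ t * f).coeff j = 0 := by
      intro j hj
      obtain ⟨i, rfl⟩ : ∃ i, j = i + t := ⟨j - t, by omega⟩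
      have h1 : (Polynomial.C (r.coeff (f.natDegree + t)) * Polynomial.X ^ t * f).coeff (i + t)
          = r.coeff (f.natDegree + t) * f.coeff i := by
        rw [mul_assoc, Polynomial.coeff_C_mul, Polynomial.coeff_X_pow_mul]
      rw [Polynomial.coeff_sub, Polynomial.coeff_C_mul, h1]
      rcases (show f.natDegree ≤ i by omega).eq_or_lt with h | h
      · subst h
        rw [Polynomial.leadingCoeff]
        ring
      · rw [Polynomial.coeff_eq_zero_of_natDegree_lt h, hr _ (by omega)]
        ring
    obtain ⟨⟨q, hq⟩, h2⟩ := ih _ key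
    refine ⟨⟨q + Polynomial.C (f.leadingCoeff ^ t) *
      (Polynomial.C (r.coeff (f.natDegree + t)) * Polynomial.X ^ t), ?_⟩, h2⟩
    have h3 : pseudoRemAux f (t + 1) r = pseudoRemAux f t
      (Polynomial.C f.leadingCoeff * r
        - Polynomial.C (r.coeff (f.natDegree + t)) * Polynomial.X ^ t * f) := rfl
    rw [h3, pow_succ, Polynomial.C_mul]
    linear_combination hq

/-- The defining property of the pseudo-remainder: `lc(f)^q g = Q f + R` with
`q = max (deg g - deg f + 1, 0)` and `deg R < deg f` (`R = 0` if `deg f = 0`). -/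
theorem pseudoRem_spec (g f : Polynomial R) :
    (∃ q : Polynomial R, Polynomial.C (f.leadingCoeff ^ (g.natDegree + 1 - f.natDegree)) * g
      = q * f + pseudoRem g f) ∧
    ∀ j, f.natDegree ≤ j → (pseudoRem g f).coeff j = 0 :=
  pseudoRemAux_spec f _ g fun _ hj => Polynomial.coeff_eq_zero_of_natDegree_lt (by omega)

end Univariate

/-! ### Class, leading variable, initial, pseudo-remainder, resultant -/

variable {K : Type*} [Field K] {n : ℕ}

/-- `F` regarded as a polynomial in `x_k`, with coefficients in the other variables. -/
def asPoly (k : Fin n) (F : MvPolynomial (Fin n) K) : Polynomial (MvPolynomial (Fin n) K) :=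
  aeval (fun j => if j = k then Polynomial.X else Polynomial.C (X j)) F

/-- The leading coefficient `lc(F, x_k)`. -/
def lcIn (F : MvPolynomial (Fin n) K) (k : Fin n) : MvPolynomial (Fin n) K :=
  (asPoly k F).leadingCoeff

/-- The pseudo-remainder `prem(G, F, x_k)`. -/
def premIn (G F : MvPolynomial (Fin n) K) (k : Fin n) : MvPolynomial (Fin n) K :=
  (pseudoRem (asPoly k G) (asPoly k F)).eval (X k)

/-- The resultant `res(F, G, x_k)`. -/
def resIn (F G : MvPolynomial (Fin n) K) (k : Fin n) : MvPolynomial (Fin n) K :=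
  Polynomial.resultant (asPoly k F) (asPoly k G)

/-- The class of `P`: the largest `p ∈ {1, …, n}` such that `x_p` occurs in `P`, and `0` if `P` is
constant. -/
def cls (P : MvPolynomial (Fin n) K) : ℕ := P.vars.sup fun j => (j : ℕ) + 1

/-- The leading variable of a nonconstant polynomial. -/
def lv (P : MvPolynomial (Fin n) K) (h : P.vars.Nonempty) : Fin n := P.vars.max' h

open Classical in
/-- The initial of a nonconstant polynomial (by convention `0` for constants). -/
def ini (P : MvPolynomial (Fin n) K) : MvPolynomial (Fin n) K :=
  if h : P.vars.Nonempty then lcIn P (lv P h) else 0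

open Classical in
/-- `deg(P, lv(P))` for a nonconstant polynomial (by convention `0` for constants). -/
def ldeg (P : MvPolynomial (Fin n) K) : ℕ :=
  if h : P.vars.Nonempty then P.degreeOf (lv P h) else 0

open Classical in
/-- `prem(P, T, lv(T))` for nonconstant `T` (by convention `0` for constant `T`). -/
def premLv (P T : MvPolynomial (Fin n) K) : MvPolynomial (Fin n) K :=
  if h : T.vars.Nonempty then premIn P T (lv T h) else 0

open Classical in
/-- `res(F, T, lv(T))` for nonconstant `T` (by convention `0` for constant `T`). -/
def resLv (F T : MvPolynomial (Fin n) K) : MvPolynomial (Fin n) K :=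
  if h : T.vars.Nonempty then resIn F T (lv T h) else 0

/-- `prem(P, [T₁, …, T_r]) = prem(⋯ prem(P, T_r, lv(T_r)) ⋯, T₁, lv(T₁))`. -/
def prem (P : MvPolynomial (Fin n) K) (T : List (MvPolynomial (Fin n) K)) :
    MvPolynomial (Fin n) K :=
  T.foldr (fun t R => premLv R t) P

/-- `res(F, [T₁, …, T_r]) = res(⋯ res(F, T_r, lv(T_r)) ⋯, T₁, lv(T₁))`. -/
def res (F : MvPolynomial (Fin n) K) (T : List (MvPolynomial (Fin n) K)) :
    MvPolynomial (Fin n) K :=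
  T.foldr (fun t R => resLv R t) F

/-! ### Triangular sets, ascending sets, ranks, Ritt characteristic sets, regular sets -/

/-- `G` is R-reduced with respect to the nonconstant polynomial `P`. -/
def IsRReduced (G P : MvPolynomial (Fin n) K) : Prop :=
  ∃ h : P.vars.Nonempty, G.degreeOf (lv P h) < P.degreeOf (lv P h)

/-- `[T₁, …, T_r]` is a triangular set: `r ≥ 1` and `0 < cls(T₁) < ⋯ < cls(T_r)`. -/
def IsTriangular (T : List (MvPolynomial (Fin n) K)) : Prop :=
  T ≠ [] ∧ (∀ t ∈ T, 0 < cls t) ∧ T.Pairwise fun s t => cls s < cls t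

/-- Ascending sets: either a single nonzero constant, or a triangular set each of whose elements is
R-reduced with respect to all the preceding ones. -/
def IsAscending (A : List (MvPolynomial (Fin n) K)) : Prop :=
  (∃ c : K, c ≠ 0 ∧ A = [C c]) ∨
    (IsTriangular A ∧ A.Pairwise fun a b => IsRReduced b a)

/-- `F ≺ G`: `F` has lower rank than `G`. -/
def LowerRank (F G : MvPolynomial (Fin n) K) : Prop :=
  cls F < cls G ∨ (cls F = cls G ∧ 0 < cls F ∧ ldeg F < ldeg G)

/-- `F ∼ G`: `F` and `G` have the same rank. -/
def SameRank (F G : MvPolynomial (Fin n) K) : Prop :=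
  ¬ LowerRank F G ∧ ¬ LowerRank G F

/-- `A' ≺ A` for ascending sets: `A'` has lower rank than `A`. -/
def LowerRankList (A' A : List (MvPolynomial (Fin n) K)) : Prop :=
  (∃ (j : ℕ) (h : j < A.length) (h' : j < A'.length),
      (∀ (i : ℕ) (hi : i < j), SameRank (A[i]'(hi.trans h)) (A'[i]'(hi.trans h'))) ∧
      LowerRank A'[j] A[j]) ∨
  (∃ h : A.length < A'.length,
      ∀ (i : ℕ) (hi : i < A.length), SameRank A[i] (A'[i]'(hi.trans h)))

/-- `A` is a Ritt characteristic set of `S` (an ideal of `K[x₁, …, xₙ]`, or an elimination ideal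
`I ∩ K[x₁, …, x_i]`): an ascending set contained in `S` of minimal rank among all such. -/
def IsRittCharSet (S : Set (MvPolynomial (Fin n) K)) (A : List (MvPolynomial (Fin n) K)) : Prop :=
  IsAscending A ∧ (∀ a ∈ A, a ∈ S) ∧
    ∀ B : List (MvPolynomial (Fin n) K), IsAscending B → (∀ b ∈ B, b ∈ S) → ¬ LowerRankList B A

/-- A triangular set `[T₁, …, T_r]` is regular if `res(ini(T_j), [T₁, …, T_{j-1}]) ≠ 0` for
`j = 2, …, r`. -/
def IsRegularSet (T : List (MvPolynomial (Fin n) K)) : Prop :=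
  IsTriangular T ∧
    ∀ (j : ℕ) (hj : j < T.length), 0 < j → res (ini T[j]) (T.take j) ≠ 0

/-- `[C₁, prem(C₂, [C₁]), …, prem(C_k, [C₁, …, C_{k-1}])]`. -/
def premList (T : List (MvPolynomial (Fin n) K)) : List (MvPolynomial (Fin n) K) :=
  T.mapIdx fun j c => prem c (T.take j)

/-! ### Reduced Gröbner bases for the purely lexicographical order -/

/-- The purely lexicographical order with `x₁ < ⋯ < xₙ`. (Mathlib's `MonomialOrder.lex` makes the
first variable the largest, hence the order dual.) -/
def plex (n : ℕ) : MonomialOrder (Fin n) where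
  syn := Lex ((Fin n)ᵒᵈ →₀ ℕ)
  toSyn :=
  { toEquiv := (Finsupp.domCongr (M := ℕ) (OrderDual.toDual (α := Fin n))).toEquiv.trans toLex
    map_add' := fun a b => by
      have h := map_add (Finsupp.domCongr (M := ℕ) (OrderDual.toDual (α := Fin n))) a b
      exact (congrArg toLex h).trans (toLex_add _ _) }
  toSyn_monotone := fun a b h => Finsupp.toLex_monotone fun i => h (OrderDual.ofDual i)

/-- `x^a < x^b` iff `a_n = b_n, …, a_{k+1} = b_{k+1}` and `a_k < b_k` for some `k`. -/
theorem plex_lt_iff (a b : Fin n →₀ ℕ) :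
    a ≺[plex n] b ↔ ∃ k, (∀ l, k < l → a l = b l) ∧ a k < b k := by
  constructor
  · rintro ⟨k, h1, h2⟩
    exact ⟨OrderDual.ofDual k, fun l hl => h1 (OrderDual.toDual l) hl, h2⟩
  · rintro ⟨k, h1, h2⟩
    exact ⟨OrderDual.toDual k, fun l hl => h1 (OrderDual.ofDual l) hl, h2⟩

/-- `f` is B-reduced with respect to `S`: no monomial of `f` is a multiple of the leading monomial
of an element of `S`. -/
def IsBReduced (S : Set (MvPolynomial (Fin n) K)) (f : MvPolynomial (Fin n) K) : Prop :=
  ¬ ∃ p ∈ S, p ≠ 0 ∧ ∃ m : Fin n →₀ ℕ, f.coeff (m + (plex n).degree p) ≠ 0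

/-- One reduction step `f = b λ p + h` with respect to `S`, where `λ = x^m`, `λ lm(p)` is the
greatest reducible monomial of `f`, and `b = coef(f, λ lm(p)) / lc(p)`. -/
def ReductionStep (S : Set (MvPolynomial (Fin n) K)) (f h : MvPolynomial (Fin n) K) : Prop :=
  ∃ p ∈ S, p ≠ 0 ∧ ∃ m : Fin n →₀ ℕ, f.coeff (m + (plex n).degree p) ≠ 0 ∧
    (∀ p' ∈ S, p' ≠ 0 → ∀ m' : Fin n →₀ ℕ, f.coeff (m' + (plex n).degree p') ≠ 0 →
      m' + (plex n).degree p' ≼[plex n] m + (plex n).degree p) ∧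
    f = monomial m (f.coeff (m + (plex n).degree p) / (plex n).leadingCoeff p) * p + h

/-- `N` is a normal form of `f` with respect to `S`: it is B-reduced and obtained from `f` by finitely
many reduction steps. -/
def IsNormalForm (S : Set (MvPolynomial (Fin n) K)) (f N : MvPolynomial (Fin n) K) : Prop :=
  Relation.ReflTransGen (ReductionStep S) f N ∧ IsBReduced S N

/-- `G` is the reduced Gröbner basis of the ideal generated by `P`. -/
def IsReducedGroebnerBasis (P : Set (MvPolynomial (Fin n) K))
    (G : Finset (MvPolynomial (Fin n) K)) : Prop :=
  (∀ f, f ∈ Ideal.span P ↔ IsNormalForm (G : Set (MvPolynomial (Fin n) K)) f 0) ∧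
  (∀ g ∈ G, (plex n).Monic g ∧ IsBReduced ((G : Set (MvPolynomial (Fin n) K)) \ {g}) g) ∧
  Ideal.span (G : Set (MvPolynomial (Fin n) K)) = Ideal.span P

/-! ### Truncations and W-characteristic sets -/

/-- Membership in `K[x₁, …, x_k] \ K[x₁, …, x_{j-1}]`; nothing is removed for `j = 0`. -/
def InBand (j k : ℕ) (f : MvPolynomial (Fin n) K) : Prop :=
  f ∈ supported K {x : Fin n | (x : ℕ) < k} ∧
    ∀ l : ℕ, j = l + 1 → f ∉ supported K {x : Fin n | (x : ℕ) < l}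

/-- The truncation `F^{⟨j,…,k⟩}` of a set of polynomials. -/
def truncation (F : Set (MvPolynomial (Fin n) K)) (j k : ℕ) : Set (MvPolynomial (Fin n) K) :=
  {f | f ∈ F ∧ InBand j k f}

open Classical in
/-- The truncation `F^{⟨j,…,k⟩}` of an ordered set of polynomials. -/
def truncationList (F : List (MvPolynomial (Fin n) K)) (j k : ℕ) :
    List (MvPolynomial (Fin n) K) :=
  F.filter fun f => decide (InBand j k f)

/-- `C` is the W-characteristic set of the ideal generated by `P`: with `G` its reduced Gröbner
basis, `C` consists, for `i = 0, …, n`, of the least element of `G^{⟨i⟩}` (if there is one), and is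
listed in increasing order. Polynomials are compared by their leading monomials. -/
def IsWCharSet (P : Set (MvPolynomial (Fin n) K)) (C : List (MvPolynomial (Fin n) K)) : Prop :=
  ∃ G : Finset (MvPolynomial (Fin n) K), IsReducedGroebnerBasis P G ∧
    (∀ g, g ∈ C ↔ ∃ i : ℕ, i ≤ n ∧ g ∈ truncation (G : Set (MvPolynomial (Fin n) K)) i i ∧
      ∀ g' ∈ truncation (G : Set (MvPolynomial (Fin n) K)) i i, g' ≠ g →
        (plex n).degree g ≺[plex n] (plex n).degree g') ∧
    C.Pairwise fun f g => (plex n).degree f ≺[plex n] (plex n).degree g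

end

end WRitt

namespace WRitt

open MvPolynomial
open scoped MonomialOrder

noncomputable section

variable {K : Type*} [Field K] {n : ℕ}

/-! ### Polynomials regarded as univariate -/

/-! Write `T` for the truncated W-characteristic set, assumed regular, and `A` for its list of
pseudo-remainders. By the pseudo-remainder formula (`prem_spec`), `A` lies in the ideal. Two facts
remain.

Regularity makes `A` an ascending set with the same classes and leading degrees as `T`
(`cls_ldeg_prem_take`). A regular set has a generic zero `φ` over an algebraically closed field
(`exists_isGenericZero`), found by solving one element after another for its leading variable. The
next initial does not vanish at `φ`: its iterated resultant is nonzero and involves only variables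
that are independent under `φ`. Applying `φ` to the coefficients therefore turns `prem(T_j, [T_1, …,
T_{j-1}])` into a nonzero constant times the image of `T_j`, whose degree in `lv(T_j)` has not
dropped (`degreeOf_prem_eq`).

The Gröbner basis makes the rank minimal. The leading monomial of a nonzero `b` in the elimination
ideal is divisible by that of some basis element `g`, and the element `c` of `T` of the same class
as `g` has no larger degree in that variable, so `b` is not R-reduced with respect to `c`. An
ascending set of lower rank would contain an element R-reduced with respect to every possible `c`
(`not_lowerRankList`). -/

theorem asPoly_add (k : Fin n) (F G : MvPolynomial (Fin n) K) :
    asPoly k (F + G) = asPoly k F + asPoly k G := map_add _ _ _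

theorem asPoly_mul (k : Fin n) (F G : MvPolynomial (Fin n) K) :
    asPoly k (F * G) = asPoly k F * asPoly k G := map_mul _ _ _

/-- `asPoly` as a ring homomorphism. -/
def asPolyHom (k : Fin n) :
    MvPolynomial (Fin n) K →+* Polynomial (MvPolynomial (Fin n) K) :=
  (aeval (R := K) fun j => if j = k then Polynomial.X else Polynomial.C (X j)).toRingHom

theorem asPolyHom_apply (k : Fin n) (F : MvPolynomial (Fin n) K) : asPolyHom k F = asPoly k F := rfl

theorem asPoly_C (k : Fin n) (a : K) : asPoly k (C a) = Polynomial.C (C a) := by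
  rw [asPoly, aeval_C]
  rfl

theorem eval_asPoly (k : Fin n) (F : MvPolynomial (Fin n) K) : (asPoly k F).eval (X k) = F := by
  have h : (Polynomial.evalRingHom (X k)).comp (asPolyHom k)
      = RingHom.id (MvPolynomial (Fin n) K) := by
    apply MvPolynomial.ringHom_ext
    · intro a
      simp [asPolyHom_apply, asPoly_C]
    · intro j
      by_cases hj : j = k <;> simp [asPolyHom_apply, asPoly, hj]
  exact congrArg (fun g => g F) h

theorem asPoly_monomial (k : Fin n) (m : Fin n →₀ ℕ) (a : K) :
    asPoly k (monomial m a) = Polynomial.monomial (m k) (monomial (m.erase k) a) := by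
  induction m using Finsupp.induction_linear generalizing a with
  | zero => simpa using asPoly_C k a
  | add f g hf hg =>
    have h1 : (monomial (f + g) a : MvPolynomial (Fin n) K) = monomial f a * monomial g 1 := by
      simp [monomial_mul]
    rw [h1, asPoly_mul, hf, hg, Polynomial.monomial_mul_monomial, monomial_mul,
      Finsupp.erase_add, Finsupp.add_apply, mul_one]
  | single j e =>
    have h1 : (monomial (Finsupp.single j e) a : MvPolynomial (Fin n) K) = C a * X j ^ e := by
      rw [C_mul_X_pow_eq_monomial]
    have h2 : asPoly k (X j : MvPolynomial (Fin n) K)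
        = if j = k then Polynomial.X else Polynomial.C (X j) := by simp [asPoly]
    have h3 : asPoly k (X j ^ e : MvPolynomial (Fin n) K) = asPoly k (X j) ^ e := map_pow _ _ _
    rw [h1, asPoly_mul, h3, asPoly_C, h2]
    by_cases hj : j = k
    · subst hj
      simp [Polynomial.C_mul_X_pow_eq_monomial]
    · rw [if_neg hj, Finsupp.erase_single_ne (Ne.symm hj), Finsupp.single_eq_of_ne (Ne.symm hj),
        Polynomial.monomial_zero_left, ← map_pow, ← Polynomial.C_mul, C_mul_X_pow_eq_monomial]

/-- An exponent vector splits uniquely into a multiple of the `k`-th unit vector and a vector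
vanishing at `k`. Exponents with `m k ≠ 0` cannot occur, since the coefficients of `asPoly k F` do
not involve `x_k`. -/
theorem coeff_coeff_asPoly (k : Fin n) (F : MvPolynomial (Fin n) K) (i : ℕ) (m : Fin n →₀ ℕ) :
    ((asPoly k F).coeff i).coeff m
      = if m k = 0 then F.coeff (m + Finsupp.single k i) else 0 := by
  induction F using MvPolynomial.induction_on' with
  | add p q hp hq =>
    rw [asPoly_add, Polynomial.coeff_add, coeff_add, hp, hq, coeff_add]
    split_ifs <;> simp
  | monomial u a =>
    rw [asPoly_monomial, Polynomial.coeff_monomial]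
    classical
    have key : (u k = i ∧ u.erase k = m) ↔ (m k = 0 ∧ u = m + Finsupp.single k i) := by
      constructor
      · rintro ⟨rfl, rfl⟩
        exact ⟨by simp, (Finsupp.erase_add_single k u).symm⟩
      · rintro ⟨h0, rfl⟩
        refine ⟨by simp [h0], ?_⟩
        ext j
        by_cases hj : j = k
        · subst hj; simp [h0]
        · simp [Finsupp.erase_ne hj]
    by_cases h : u k = i ∧ u.erase k = m
    · rw [if_pos h.1, if_pos (key.1 h).1, coeff_monomial, coeff_monomial, if_pos h.2,
        if_pos (key.1 h).2]
    · have h' := h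
      rw [key] at h'
      by_cases h1 : u k = i <;> by_cases h2 : m k = 0 <;> simp_all [coeff_monomial]

theorem natDegree_asPoly (k : Fin n) (F : MvPolynomial (Fin n) K) :
    (asPoly k F).natDegree = F.degreeOf k := by
  apply le_antisymm
  · rw [Polynomial.natDegree_le_iff_coeff_eq_zero]
    intro i hi
    ext m
    rw [coeff_coeff_asPoly, coeff_zero]
    split_ifs with h
    · by_contra hne
      have := monomial_le_degreeOf k (mem_support_iff.2 hne)
      simp [h] at this
      omega
    · rfl
  · rw [degreeOf_le_iff]
    intro m hm
    apply Polynomial.le_natDegree_of_ne_zero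
    intro h0
    have := coeff_coeff_asPoly k F (m k) (m.erase k)
    rw [h0, if_pos (by simp), Finsupp.erase_add_single] at this
    exact (mem_support_iff.1 hm) (by simpa using this.symm)

theorem degreeOf_coeff_asPoly (k y : Fin n) (F : MvPolynomial (Fin n) K) (i : ℕ) :
    ((asPoly k F).coeff i).degreeOf y ≤ F.degreeOf y := by
  rw [degreeOf_le_iff]
  intro m hm
  rw [mem_support_iff, coeff_coeff_asPoly] at hm
  split_ifs at hm with h
  · have := monomial_le_degreeOf y (mem_support_iff.2 hm)
    rw [Finsupp.add_apply] at this
    omega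
  · exact absurd rfl hm

theorem degreeOf_coeff_asPoly_self (k : Fin n) (F : MvPolynomial (Fin n) K) (i : ℕ) :
    ((asPoly k F).coeff i).degreeOf k = 0 := by
  rw [← Nat.le_zero, degreeOf_le_iff]
  intro m hm
  rw [mem_support_iff, coeff_coeff_asPoly] at hm
  by_contra h
  exact hm (if_neg (by omega))

theorem asPoly_of_degreeOf_eq_zero {k : Fin n} {F : MvPolynomial (Fin n) K}
    (h : F.degreeOf k = 0) : asPoly k F = Polynomial.C F := by
  have h1 := Polynomial.eq_C_of_natDegree_eq_zero ((natDegree_asPoly k F).trans h)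
  have h2 := eval_asPoly k F
  rw [h1, Polynomial.eval_C] at h2
  rw [h1, h2]

theorem asPoly_ne_zero {k : Fin n} {F : MvPolynomial (Fin n) K} (h : F ≠ 0) : asPoly k F ≠ 0 := by
  intro h0
  apply h
  rw [← eval_asPoly k F, h0, Polynomial.eval_zero]

theorem lcIn_ne_zero {k : Fin n} {F : MvPolynomial (Fin n) K} (h : F ≠ 0) : lcIn F k ≠ 0 :=
  Polynomial.leadingCoeff_ne_zero.2 (asPoly_ne_zero h)

/-! ### Class, leading variable and leading degree -/

theorem cls_le_iff {F : MvPolynomial (Fin n) K} {m : ℕ} :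
    cls F ≤ m ↔ ∀ j : Fin n, m ≤ (j : ℕ) → F.degreeOf j = 0 := by
  rw [cls, Finset.sup_le_iff]
  constructor
  · intro h j hj
    by_contra hne
    have := h j (mem_vars_iff_degreeOf_ne_zero.2 hne)
    omega
  · intro h j hj
    by_contra hlt
    exact mem_vars_iff_degreeOf_ne_zero.1 hj (h j (by omega))

theorem cls_le (F : MvPolynomial (Fin n) K) : cls F ≤ n :=
  cls_le_iff.2 fun j hj => absurd j.2 (by omega)

theorem degreeOf_eq_zero_of_cls_le {F : MvPolynomial (Fin n) K} {j : Fin n} (h : cls F ≤ j) :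
    F.degreeOf j = 0 := cls_le_iff.1 h j le_rfl

theorem exists_cls_eq {F : MvPolynomial (Fin n) K} (h : 0 < cls F) :
    ∃ k : Fin n, cls F = k + 1 := by
  have := cls_le F
  exact ⟨⟨cls F - 1, by omega⟩, by simp; omega⟩

theorem degreeOf_pos {F : MvPolynomial (Fin n) K} {k : Fin n} (h : cls F = k + 1) :
    0 < F.degreeOf k := by
  by_contra h0
  have : cls F ≤ k := cls_le_iff.2 fun j hj => by
    rcases hj.eq_or_lt with e | e
    · rw [← Fin.ext e]
      omega
    · exact degreeOf_eq_zero_of_cls_le (by omega)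
  omega

theorem cls_eq_of_degreeOf_pos {F : MvPolynomial (Fin n) K} {k : Fin n} (h : cls F ≤ k + 1)
    (h0 : 0 < F.degreeOf k) : cls F = k + 1 := by
  by_contra hne
  have : F.degreeOf k = 0 := degreeOf_eq_zero_of_cls_le (by omega)
  omega

theorem ne_zero_of_cls_pos {F : MvPolynomial (Fin n) K} (h : 0 < cls F) : F ≠ 0 := by
  rintro rfl
  simp [cls] at h

theorem vars_nonempty {F : MvPolynomial (Fin n) K} {k : Fin n} (h : cls F = k + 1) :
    F.vars.Nonempty := ⟨k, mem_vars_iff_degreeOf_ne_zero.2 (degreeOf_pos h).ne'⟩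

theorem cls_eq_lv {F : MvPolynomial (Fin n) K} (h : F.vars.Nonempty) : cls F = lv F h + 1 := by
  apply cls_eq_of_degreeOf_pos
  · rw [cls, Finset.sup_le_iff]
    intro j hj
    have : j ≤ lv F h := Finset.le_max' _ _ hj
    have : (j : ℕ) ≤ lv F h := this
    omega
  · exact Nat.pos_of_ne_zero (mem_vars_iff_degreeOf_ne_zero.1 (Finset.max'_mem _ _))

theorem lv_eq {F : MvPolynomial (Fin n) K} {k : Fin n} (h : cls F = k + 1) :
    lv F (vars_nonempty h) = k := by
  have := cls_eq_lv (vars_nonempty h)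
  exact Fin.ext (by omega)

theorem ini_eq {F : MvPolynomial (Fin n) K} {k : Fin n} (h : cls F = k + 1) :
    ini F = lcIn F k := by
  rw [ini, dif_pos (vars_nonempty h), lv_eq h]

theorem ldeg_eq {F : MvPolynomial (Fin n) K} {k : Fin n} (h : cls F = k + 1) :
    ldeg F = F.degreeOf k := by
  rw [ldeg, dif_pos (vars_nonempty h), lv_eq h]

theorem premLv_eq {F : MvPolynomial (Fin n) K} {k : Fin n} (h : cls F = k + 1)
    (P : MvPolynomial (Fin n) K) : premLv P F = premIn P F k := by
  rw [premLv, dif_pos (vars_nonempty h), lv_eq h]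

theorem resLv_eq {F : MvPolynomial (Fin n) K} {k : Fin n} (h : cls F = k + 1)
    (P : MvPolynomial (Fin n) K) : resLv P F = resIn P F k := by
  rw [resLv, dif_pos (vars_nonempty h), lv_eq h]

theorem isRReduced_iff {F : MvPolynomial (Fin n) K} {k : Fin n} (h : cls F = k + 1)
    (G : MvPolynomial (Fin n) K) : IsRReduced G F ↔ G.degreeOf k < F.degreeOf k := by
  constructor
  · rintro ⟨h', hlt⟩
    rwa [lv_eq h] at hlt
  · intro hlt
    refine ⟨vars_nonempty h, ?_⟩
    rwa [lv_eq h]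

theorem mem_supported_lt_iff {F : MvPolynomial (Fin n) K} {m : ℕ} :
    F ∈ supported K {x : Fin n | (x : ℕ) < m} ↔ cls F ≤ m := by
  rw [mem_supported, cls_le_iff]
  constructor
  · intro h j hj
    by_contra hne
    have : (j : ℕ) < m := h (mem_vars_iff_degreeOf_ne_zero.2 hne)
    omega
  · intro h j hj
    by_contra hlt
    exact mem_vars_iff_degreeOf_ne_zero.1 hj (h j (by simpa using hlt))

theorem inBand_zero_iff {F : MvPolynomial (Fin n) K} {i : ℕ} : InBand 0 i F ↔ cls F ≤ i := by
  rw [InBand, mem_supported_lt_iff]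
  exact and_iff_left fun l hl => absurd hl (by omega)

theorem inBand_self_iff {F : MvPolynomial (Fin n) K} {i : ℕ} : InBand i i F ↔ cls F = i := by
  rw [InBand, mem_supported_lt_iff]
  constructor
  · rintro ⟨h1, h2⟩
    cases i with
    | zero => omega
    | succ l =>
      have := h2 l rfl
      rw [mem_supported_lt_iff] at this
      omega
  · rintro rfl
    refine ⟨le_rfl, fun l hl => ?_⟩
    rw [mem_supported_lt_iff]
    omega

/-! ### Pseudo-remainders -/

/-- A pseudo-division step only multiplies coefficients of the dividend by coefficients of `f` and
subtracts, so it stays inside any `S`-module `N`. With `S` the polynomials free of a variable and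
`N` those of bounded degree in it, this controls the degrees of pseudo-remainders. -/
theorem coeff_pseudoRemAux_mem {R : Type*} [CommRing R] (S : Subring R) (N : AddSubgroup R)
    (hN : ∀ s ∈ S, ∀ x ∈ N, s * x ∈ N) {f : Polynomial R} (hf : ∀ j, f.coeff j ∈ S) (t : ℕ)
    (r : Polynomial R) (hr : ∀ j, r.coeff j ∈ N) (j : ℕ) : (pseudoRemAux f t r).coeff j ∈ N := by
  induction t generalizing r with
  | zero => exact hr j
  | succ t ih =>
    apply ih
    intro i
    rw [Polynomial.coeff_sub, Polynomial.coeff_C_mul, mul_assoc, Polynomial.coeff_C_mul,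
      Polynomial.coeff_X_pow_mul']
    refine N.sub_mem (hN _ (hf _) _ (hr _)) ?_
    split_ifs
    · rw [mul_comm]
      exact hN _ (hf _) _ (hr _)
    · rw [mul_zero]
      exact N.zero_mem

/-- The polynomials of degree at most `d` in `x_y`. -/
def degreeOfLE (y : Fin n) (d : ℕ) : AddSubgroup (MvPolynomial (Fin n) K) where
  carrier := {p | p.degreeOf y ≤ d}
  zero_mem' := by simp
  add_mem' := fun {a b} ha hb => (degreeOf_add_le y a b).trans (max_le ha hb)
  neg_mem' := fun {a} ha => by
    change degreeOf y (-a) ≤ d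
    have ha' : degreeOf y a ≤ d := ha
    rw [degreeOf_le_iff] at ha' ⊢
    simpa using ha'

/-- The polynomials in which `x_y` does not occur. -/
def withoutVar (y : Fin n) : Subring (MvPolynomial (Fin n) K) where
  __ := degreeOfLE y 0
  one_mem' := by
    change degreeOf y 1 ≤ 0
    simp
  mul_mem' := fun {a b} ha hb => by
    have ha' : degreeOf y a ≤ 0 := ha
    have hb' : degreeOf y b ≤ 0 := hb
    change degreeOf y (a * b) ≤ 0
    have := degreeOf_mul_le y a b
    omega

theorem mem_degreeOfLE {y : Fin n} {d : ℕ} {p : MvPolynomial (Fin n) K} :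
    p ∈ degreeOfLE y d ↔ p.degreeOf y ≤ d := Iff.rfl

theorem mem_withoutVar {y : Fin n} {p : MvPolynomial (Fin n) K} :
    p ∈ withoutVar y ↔ p.degreeOf y = 0 := Nat.le_zero

theorem degreeOf_eval_X_le {k y : Fin n} {d e : ℕ}
    {p : Polynomial (MvPolynomial (Fin n) K)} (hp : ∀ j, (p.coeff j).degreeOf y ≤ d)
    (he : ∀ j, p.coeff j ≠ 0 → (X k ^ j : MvPolynomial (Fin n) K).degreeOf y ≤ e) :
    (p.eval (X k)).degreeOf y ≤ d + e := by
  rw [Polynomial.eval_eq_sum, Polynomial.sum]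
  refine (degreeOf_sum_le _ _ _).trans (Finset.sup_le fun j hj => ?_)
  exact (degreeOf_mul_le _ _ _).trans
    (add_le_add (hp j) (he j (Polynomial.mem_support_iff.1 hj)))

theorem degreeOf_premIn_le {k y : Fin n} {G F : MvPolynomial (Fin n) K} (hyk : y ≠ k)
    (hF : F.degreeOf y = 0) : (premIn G F k).degreeOf y ≤ G.degreeOf y := by
  refine (degreeOf_eval_X_le (d := G.degreeOf y) (e := 0) (fun j => ?_) fun j _ => ?_)
  · refine coeff_pseudoRemAux_mem (withoutVar y) (degreeOfLE y (G.degreeOf y)) ?_ ?_ _ _ ?_ j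
    · intro s hs x hx
      rw [mem_withoutVar] at hs
      rw [mem_degreeOfLE] at hx ⊢
      exact (degreeOf_mul_le _ _ _).trans (by omega)
    · intro j
      have := degreeOf_coeff_asPoly k y F j
      rw [mem_withoutVar]
      omega
    · intro j
      exact degreeOf_coeff_asPoly k y G j
  · exact (degreeOf_X_pow_of_ne _ hyk).le

theorem degreeOf_premIn_lt {k : Fin n} {G F : MvPolynomial (Fin n) K} (hF : 0 < F.degreeOf k) :
    (premIn G F k).degreeOf k < F.degreeOf k := by
  -- The coefficients contribute degree `0` in `x_k`; the powers of `x_k` that occur have exponent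
  -- at most `F.degreeOf k - 1`.
  have h : (premIn G F k).degreeOf k ≤ 0 + (F.degreeOf k - 1) := by
    refine degreeOf_eval_X_le (fun j => ?_) fun j hj => ?_
    · refine coeff_pseudoRemAux_mem (withoutVar k) (degreeOfLE k 0) ?_ ?_ _ _ ?_ j
      · intro s hs x hx
        rw [mem_withoutVar] at hs
        rw [mem_degreeOfLE] at hx ⊢
        exact (degreeOf_mul_le _ _ _).trans (by omega)
      · intro j
        exact (degreeOf_coeff_asPoly_self k F j).le
      · intro j
        exact (degreeOf_coeff_asPoly_self k G j).le
    · have h2 := (pseudoRem_spec (asPoly k G) (asPoly k F)).2 j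
      rw [natDegree_asPoly] at h2
      rw [degreeOf_X_self_pow]
      by_contra hlt
      exact hj (h2 (by omega))
  omega

theorem premIn_spec (G F : MvPolynomial (Fin n) K) (k : Fin n) :
    ∃ (e : ℕ) (q : MvPolynomial (Fin n) K), lcIn F k ^ e * G = q * F + premIn G F k := by
  obtain ⟨⟨q, hq⟩, -⟩ := pseudoRem_spec (asPoly k G) (asPoly k F)
  have := congrArg (Polynomial.eval (X k)) hq
  rw [Polynomial.eval_mul, Polynomial.eval_C, Polynomial.eval_add, Polynomial.eval_mul,
    eval_asPoly, eval_asPoly] at this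
  exact ⟨_, _, this⟩

theorem degreeOf_premLv_le {y : Fin n} {G F : MvPolynomial (Fin n) K} (hF0 : 0 < cls F)
    (hF : F.degreeOf y = 0) : (premLv G F).degreeOf y ≤ G.degreeOf y := by
  obtain ⟨k, hk⟩ := exists_cls_eq hF0
  rw [premLv_eq hk]
  refine degreeOf_premIn_le ?_ hF
  rintro rfl
  have := degreeOf_pos hk
  omega

theorem prem_cons (P t : MvPolynomial (Fin n) K) (T : List (MvPolynomial (Fin n) K)) :
    prem P (t :: T) = premLv (prem P T) t := rfl

theorem res_cons (P t : MvPolynomial (Fin n) K) (T : List (MvPolynomial (Fin n) K)) :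
    res P (t :: T) = resLv (res P T) t := rfl

theorem degreeOf_prem_le {y : Fin n} {P : MvPolynomial (Fin n) K}
    {T : List (MvPolynomial (Fin n) K)} (hT : ∀ t ∈ T, 0 < cls t)
    (hy : ∀ t ∈ T, t.degreeOf y = 0) : (prem P T).degreeOf y ≤ P.degreeOf y := by
  induction T with
  | nil => exact le_rfl
  | cons t T ih =>
    rw [List.forall_mem_cons] at hT hy
    exact (degreeOf_premLv_le hT.1 hy.1).trans (ih hT.2 hy.2)

/-- Dividing by `t` lowers the degree in `lv(t)` below that of `t`. The later divisors have smaller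
class, hence do not involve `lv(t)`, and cannot raise this degree again. -/
theorem isRReduced_prem {P : MvPolynomial (Fin n) K} {T : List (MvPolynomial (Fin n) K)}
    (hT : ∀ t ∈ T, 0 < cls t) (hp : T.Pairwise fun s t => cls s < cls t) :
    ∀ t ∈ T, IsRReduced (prem P T) t := by
  induction T with
  | nil => simp
  | cons s T ih =>
    rw [List.forall_mem_cons] at hT
    rw [List.pairwise_cons] at hp
    intro t ht
    rcases List.mem_cons.1 ht with rfl | ht
    · obtain ⟨k, hk⟩ := exists_cls_eq hT.1
      rw [isRReduced_iff hk, prem_cons, premLv_eq hk]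
      exact degreeOf_premIn_lt (degreeOf_pos hk)
    · have h1 := ih hT.2 hp.2 t ht
      obtain ⟨k, hk⟩ := exists_cls_eq (hT.2 t ht)
      rw [isRReduced_iff hk] at h1 ⊢
      have := hp.1 t ht
      exact (degreeOf_premLv_le hT.1 (degreeOf_eq_zero_of_cls_le (by omega))).trans_lt h1

/-- `prem(P, T)` is congruent, modulo the ideal generated by `T`, to the product of `P` with a
product of initials of `T`. -/
theorem prem_spec (P : MvPolynomial (Fin n) K) {T : List (MvPolynomial (Fin n) K)}
    (hT : ∀ t ∈ T, 0 < cls t) :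
    ∃ J ∈ Submonoid.closure {I | ∃ t ∈ T, ini t = I},
      J * P - prem P T ∈ Ideal.span {t | t ∈ T} := by
  induction T with
  | nil => exact ⟨1, one_mem _, by simp [prem]⟩
  | cons t T ih =>
    rw [List.forall_mem_cons] at hT
    obtain ⟨J, hJ, hmem⟩ := ih hT.2
    obtain ⟨k, hk⟩ := exists_cls_eq hT.1
    obtain ⟨e, q, hq⟩ := premIn_spec (prem P T) t k
    refine ⟨ini t ^ e * J, mul_mem (pow_mem
      (Submonoid.subset_closure (s := {I | ∃ s ∈ t :: T, ini s = I}) ⟨t, by simp, rfl⟩) _)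
      (Submonoid.closure_mono ?_ hJ), ?_⟩
    · rintro _ ⟨s, hs, rfl⟩
      exact ⟨s, by simp [hs], rfl⟩
    · have h1 : ini t ^ e * J * P - prem P (t :: T)
          = ini t ^ e * (J * P - prem P T) + q * t := by
        rw [prem_cons, premLv_eq hk, ini_eq hk]
        linear_combination hq
      rw [h1]
      refine add_mem (Ideal.mul_mem_left _ _ (Ideal.span_mono ?_ hmem))
        (Ideal.mul_mem_left _ _ (Ideal.subset_span (by simp)))
      intro s hs
      exact List.mem_cons_of_mem _ hs

/-! ### Resultants -/

/-- The resultant is the determinant of the Sylvester matrix, whose entries are coefficients of `f`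
and `g` or zero. It serves to show that a resultant is free of a given variable. -/
theorem resultant_mem {R : Type*} [CommRing R] (S : Subring R) {f g : Polynomial R}
    (hf : ∀ j, f.coeff j ∈ S) (hg : ∀ j, g.coeff j ∈ S) (a b : ℕ) :
    Polynomial.resultant f g a b ∈ S := by
  rw [Polynomial.resultant, Matrix.det_apply]
  refine S.sum_mem fun σ _ => ?_
  rw [Units.smul_def]
  refine S.zsmul_mem (S.prod_mem fun i _ => ?_) _
  rw [Polynomial.sylvester, Matrix.of_apply]
  induction i using Fin.addCases with
  | left i =>
    rw [Fin.addCases_left]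
    split_ifs
    exacts [hg _, S.zero_mem]
  | right i =>
    rw [Fin.addCases_right]
    split_ifs
    exacts [hf _, S.zero_mem]

theorem degreeOf_resLv_eq_zero {y : Fin n} {F G : MvPolynomial (Fin n) K} (hG : 0 < cls G)
    (h : (F.degreeOf y = 0 ∧ G.degreeOf y = 0) ∨ cls G = y + 1) : (resLv F G).degreeOf y = 0 := by
  obtain ⟨k, hk⟩ := exists_cls_eq hG
  rw [resLv_eq hk, ← mem_withoutVar]
  rcases h with h | h
  · refine resultant_mem _ (fun j => ?_) (fun j => ?_) _ _
    · have := degreeOf_coeff_asPoly k y F j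
      rw [mem_withoutVar]
      omega
    · have := degreeOf_coeff_asPoly k y G j
      rw [mem_withoutVar]
      omega
  · have hy : k = y := Fin.ext (by omega)
    subst hy
    exact resultant_mem _ (fun j => mem_withoutVar.2 (degreeOf_coeff_asPoly_self k F j))
      (fun j => mem_withoutVar.2 (degreeOf_coeff_asPoly_self k G j)) _ _

/-- The resultant with `t` eliminates `lv(t)`, and the elements treated afterwards have smaller
class, so they do not bring it back. -/
theorem degreeOf_res_eq_zero {P : MvPolynomial (Fin n) K} {T : List (MvPolynomial (Fin n) K)}
    (hT : ∀ t ∈ T, 0 < cls t) (hp : T.Pairwise fun s t => cls s < cls t) {y : Fin n}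
    (hy : ∃ t ∈ T, cls t = y + 1) : (res P T).degreeOf y = 0 := by
  induction T with
  | nil => simp at hy
  | cons s T ih =>
    rw [List.forall_mem_cons] at hT
    rw [List.pairwise_cons] at hp
    obtain ⟨t, ht, hty⟩ := hy
    refine degreeOf_resLv_eq_zero hT.1 ?_
    rcases List.mem_cons.1 ht with rfl | ht
    · exact Or.inr hty
    · have := hp.1 t ht
      exact Or.inl ⟨ih hT.2 hp.2 ⟨t, ht, hty⟩, degreeOf_eq_zero_of_cls_le (by omega)⟩

/-- Each resultant lies in the ideal generated by its two arguments, so a common zero of `P` and `T`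
is a zero of the iterated resultant. The positive degree of `t` in its leading variable excludes the
degenerate case of two constants. -/
theorem map_res_eq_zero {R : Type*} [CommRing R] (φ : MvPolynomial (Fin n) K →+* R)
    {P : MvPolynomial (Fin n) K} {T : List (MvPolynomial (Fin n) K)}
    (hT : ∀ t ∈ T, 0 < cls t) (hφ : ∀ t ∈ T, φ t = 0) (hP : φ P = 0) : φ (res P T) = 0 := by
  induction T with
  | nil => exact hP
  | cons t T ih =>
    rw [List.forall_mem_cons] at hT hφ
    obtain ⟨k, hk⟩ := exists_cls_eq hT.1
    have hd : (asPoly k t).natDegree ≠ 0 := by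
      rw [natDegree_asPoly]
      exact (degreeOf_pos hk).ne'
    obtain ⟨p, q, -, -, h⟩ := Polynomial.exists_mul_add_mul_eq_C_resultant
      (asPoly k (res P T)) (asPoly k t) le_rfl le_rfl (Or.inr hd)
    have h1 := congrArg (Polynomial.eval (X k)) h
    rw [Polynomial.eval_C, Polynomial.eval_add, Polynomial.eval_mul, Polynomial.eval_mul,
      eval_asPoly, eval_asPoly] at h1
    rw [res_cons, resLv_eq hk, resIn, ← h1, map_add, map_mul, map_mul, ih hT.2 hφ.2, hφ.1]
    simp

/-! ### Generic zeros of regular sets -/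

theorem degreeOf_ini_self {F : MvPolynomial (Fin n) K} {k : Fin n} (h : cls F = k + 1) :
    (ini F).degreeOf k = 0 := by
  rw [ini_eq h]
  exact degreeOf_coeff_asPoly_self k F _

theorem degreeOf_ini_eq_zero {F : MvPolynomial (Fin n) K} {k : Fin n} (hF : 0 < cls F)
    (h : F.degreeOf k = 0) : (ini F).degreeOf k = 0 := by
  obtain ⟨l, hl⟩ := exists_cls_eq hF
  rw [ini_eq hl]
  have := degreeOf_coeff_asPoly l k F (asPoly l F).natDegree
  exact Nat.le_zero.1 (this.trans h.le)

theorem ini_ne_zero {F : MvPolynomial (Fin n) K} (h : 0 < cls F) : ini F ≠ 0 := by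
  obtain ⟨k, hk⟩ := exists_cls_eq h
  rw [ini_eq hk]
  exact lcIn_ne_zero (ne_zero_of_cls_pos h)

/-- `φ` is a zero of `T` at which no initial of `T` vanishes, and which satisfies no algebraic
relation between the variables other than the leading variables of `T`. -/
structure IsGenericZero {L : Type*} [Field L] (φ : MvPolynomial (Fin n) K →+* L)
    (T : List (MvPolynomial (Fin n) K)) : Prop where
  map_eq_zero : ∀ t ∈ T, φ t = 0
  map_ini_ne_zero : ∀ t ∈ T, φ (ini t) ≠ 0
  map_ne_zero : ∀ F ≠ 0, (∀ k : Fin n, (∃ t ∈ T, cls t = k + 1) → F.degreeOf k = 0) → φ F ≠ 0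

/-- If `φ` killed `P`, it would kill the iterated resultant; but that is a nonzero polynomial free
of the leading variables of `T`. -/
theorem IsGenericZero.map_ne_zero_of_res_ne_zero {L : Type*} [Field L]
    {φ : MvPolynomial (Fin n) K →+* L} {T : List (MvPolynomial (Fin n) K)}
    (hφ : IsGenericZero φ T) (hT : ∀ t ∈ T, 0 < cls t)
    (hp : T.Pairwise fun s t => cls s < cls t) {P : MvPolynomial (Fin n) K} (hP : res P T ≠ 0) :
    φ P ≠ 0 := fun h =>
  hφ.map_ne_zero _ hP (fun _ hk => degreeOf_res_eq_zero hT hp hk)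
    (map_res_eq_zero φ hT hφ.map_eq_zero h)

/-- Induction on the length, starting from an embedding, under which all variables are independent.
Adding `t` at the end changes only the value of `lv(t)`, which becomes a root of `t`. -/
theorem exists_isGenericZero (L : Type*) [Field L] [IsAlgClosed L]
    (φ₀ : MvPolynomial (Fin n) K →+* L) (hφ₀ : Function.Injective φ₀)
    {T : List (MvPolynomial (Fin n) K)} (hT : ∀ t ∈ T, 0 < cls t)
    (hp : T.Pairwise fun s t => cls s < cls t)
    (hreg : ∀ (j : ℕ) (hj : j < T.length), res (ini T[j]) (T.take j) ≠ 0) :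
    ∃ φ : MvPolynomial (Fin n) K →+* L, IsGenericZero φ T := by
  induction T using List.reverseRecOn with
  | nil => exact ⟨φ₀, by simp, by simp, fun F hF _ => (map_ne_zero_iff φ₀ hφ₀).2 hF⟩
  | append_singleton T t ih =>
    have hT' : ∀ s ∈ T, 0 < cls s := fun s hs => hT s (by simp [hs])
    have ht : 0 < cls t := hT t (by simp)
    rw [List.pairwise_append] at hp
    have hlt : ∀ s ∈ T, cls s < cls t := fun s hs => hp.2.2 s hs t (by simp)
    obtain ⟨φ, hφ⟩ := ih hT' hp.1 fun j hj => by
      have := hreg j (by simp; omega)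
      rwa [List.getElem_append_left hj, List.take_append_of_le_length hj.le] at this
    have hini : φ (ini t) ≠ 0 := hφ.map_ne_zero_of_res_ne_zero hT' hp.1 (by
      simpa using hreg T.length (by simp))
    obtain ⟨k, hk⟩ := exists_cls_eq ht
    -- Since the initial survives `φ`, the specialised polynomial keeps its positive degree and has
    -- a root.
    have hdeg : ((asPoly k t).map φ).natDegree = t.degreeOf k := by
      rw [Polynomial.natDegree_map_of_leadingCoeff_ne_zero, natDegree_asPoly]
      rwa [ini_eq hk] at hini
    obtain ⟨y, hy⟩ := IsAlgClosed.exists_root ((asPoly k t).map φ) (by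
      intro h0
      have := Polynomial.natDegree_eq_zero_iff_degree_le_zero.2 h0.le
      have := degreeOf_pos hk
      omega)
    -- `φ'` sends `x_k` to the root `y` and agrees with `φ` on all other variables.
    let φ' : MvPolynomial (Fin n) K →+* L :=
      ((Polynomial.evalRingHom y).comp (Polynomial.mapRingHom φ)).comp (asPolyHom k)
    have hφ' : ∀ F : MvPolynomial (Fin n) K, F.degreeOf k = 0 → φ' F = φ F := by
      intro F hF
      simp [φ', asPolyHom_apply, asPoly_of_degreeOf_eq_zero hF]
    have hfree : ∀ s ∈ T, s.degreeOf k = 0 := fun s hs =>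
      degreeOf_eq_zero_of_cls_le (by have := hlt s hs; omega)
    refine ⟨φ', ?_, ?_, ?_⟩
    · intro s hs
      rcases List.mem_append.1 hs with hs | hs
      · rw [hφ' s (hfree s hs)]
        exact hφ.map_eq_zero s hs
      · rw [List.mem_singleton.1 hs]
        exact hy
    · intro s hs
      rcases List.mem_append.1 hs with hs | hs
      · rw [hφ' _ (degreeOf_ini_eq_zero (hT' s hs) (hfree s hs))]
        exact hφ.map_ini_ne_zero s hs
      · rw [List.mem_singleton.1 hs, hφ' _ (degreeOf_ini_self hk)]
        exact hini
    · intro F hF h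
      rw [hφ' F (h k ⟨t, by simp, hk⟩)]
      exact hφ.map_ne_zero F hF fun l ⟨s, hs, hl⟩ => h l ⟨s, by simp [hs], hl⟩

/-- The pseudo-remainder of `P` with respect to `T` keeps the degree of `P` in its leading variable,
provided that this variable exceeds those of `T` and `ini(P)` does not vanish at a generic zero. -/
theorem degreeOf_prem_eq {L : Type*} [Field L] {φ : MvPolynomial (Fin n) K →+* L}
    {T : List (MvPolynomial (Fin n) K)} (hφ : IsGenericZero φ T) (hT : ∀ t ∈ T, 0 < cls t)
    {P : MvPolynomial (Fin n) K} {k : Fin n} (hk : cls P = k + 1) (hlt : ∀ t ∈ T, cls t < cls P)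
    (hini : φ (ini P) ≠ 0) : (prem P T).degreeOf k = P.degreeOf k := by
  have hfree : ∀ s ∈ T, s.degreeOf k = 0 := fun s hs =>
    degreeOf_eq_zero_of_cls_le (by have := hlt s hs; omega)
  apply le_antisymm (degreeOf_prem_le hT hfree)
  -- `ψ` keeps `x_k` as an indeterminate and specialises the other variables by `φ`. It kills `T`
  -- and sends the initials of `T` to nonzero constants.
  let ψ : MvPolynomial (Fin n) K →+* Polynomial L := (Polynomial.mapRingHom φ).comp (asPolyHom k)
  have hψ : ∀ F : MvPolynomial (Fin n) K, F.degreeOf k = 0 → ψ F = Polynomial.C (φ F) := by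
    intro F hF
    simp [ψ, asPolyHom_apply, asPoly_of_degreeOf_eq_zero hF]
  obtain ⟨J, hJ, hmem⟩ := prem_spec P hT
  have hker : Ideal.span {t | t ∈ T} ≤ RingHom.ker ψ := Ideal.span_le.2 fun s hs => by
    change ψ s = 0
    rw [hψ s (hfree s hs), hφ.map_eq_zero s hs, Polynomial.C_0]
  have hJ' : ∃ c ≠ 0, ψ J = Polynomial.C c := by
    clear hmem
    induction hJ using Submonoid.closure_induction with
    | mem x hx =>
      obtain ⟨t, ht, rfl⟩ := hx
      exact ⟨_, hφ.map_ini_ne_zero t ht, hψ _ (degreeOf_ini_eq_zero (hT t ht) (hfree t ht))⟩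
    | one => exact ⟨1, one_ne_zero, by simp⟩
    | mul x y _ _ hx hy =>
      obtain ⟨a, ha, hxa⟩ := hx
      obtain ⟨b, hb, hyb⟩ := hy
      exact ⟨a * b, mul_ne_zero ha hb, by rw [map_mul, hxa, hyb, Polynomial.C_mul]⟩
  obtain ⟨c, hc, hJc⟩ := hJ'
  have h1 : ψ (prem P T) = Polynomial.C c * ψ P := by
    have : ψ (J * P - prem P T) = 0 := hker hmem
    rw [map_sub, map_mul, hJc, sub_eq_zero] at this
    exact this.symm
  have h2 : (ψ P).natDegree = P.degreeOf k := by
    change ((asPoly k P).map φ).natDegree = _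
    rw [Polynomial.natDegree_map_of_leadingCoeff_ne_zero, natDegree_asPoly]
    rwa [ini_eq hk] at hini
  have h3 : (ψ (prem P T)).natDegree ≤ (prem P T).degreeOf k := by
    rw [← natDegree_asPoly]
    exact Polynomial.natDegree_map_le
  rwa [h1, Polynomial.natDegree_C_mul hc, h2] at h3

theorem cls_prem {L : Type*} [Field L] {φ : MvPolynomial (Fin n) K →+* L}
    {T : List (MvPolynomial (Fin n) K)} (hφ : IsGenericZero φ T) (hT : ∀ t ∈ T, 0 < cls t)
    {P : MvPolynomial (Fin n) K} {k : Fin n} (hk : cls P = k + 1) (hlt : ∀ t ∈ T, cls t < cls P)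
    (hini : φ (ini P) ≠ 0) : cls (prem P T) = k + 1 := by
  apply cls_eq_of_degreeOf_pos
  · refine cls_le_iff.2 fun j hj => Nat.le_zero.1 ((degreeOf_prem_le hT fun t ht => ?_).trans ?_)
    · exact degreeOf_eq_zero_of_cls_le (by have := hlt t ht; omega)
    · exact (degreeOf_eq_zero_of_cls_le (by omega)).le
  · rw [degreeOf_prem_eq hφ hT hk hlt hini]
    exact degreeOf_pos hk

/-- Replacing each element of a regular set by its pseudo-remainder with respect to the preceding
ones changes neither the classes nor the degrees in the leading variables. -/
theorem cls_ldeg_prem_take {T : List (MvPolynomial (Fin n) K)} (hT : IsRegularSet T) {j : ℕ}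
    (hj : j < T.length) :
    cls (prem T[j] (T.take j)) = cls T[j] ∧ ldeg (prem T[j] (T.take j)) = ldeg T[j] := by
  obtain ⟨⟨-, hpos, hp⟩, hreg⟩ := hT
  have hpos' : ∀ t ∈ T.take j, 0 < cls t := fun t ht => hpos t (List.mem_of_mem_take ht)
  have hp' : (T.take j).Pairwise fun s t => cls s < cls t := hp.sublist (List.take_sublist _ _)
  -- Regularity says nothing at index `0`; there the iterated resultant is the initial itself, which
  -- is nonzero.
  have hreg' : ∀ (l : ℕ) (hl : l < T.length), res (ini T[l]) (T.take l) ≠ 0 := by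
    intro l hl
    rcases Nat.eq_zero_or_pos l with rfl | h
    · exact ini_ne_zero (hpos _ (List.getElem_mem hl))
    · exact hreg l hl h
  let R := MvPolynomial (Fin n) K
  -- Any algebraically closed field into which the polynomial ring embeds would do.
  obtain ⟨φ, hφ⟩ := exists_isGenericZero (AlgebraicClosure (FractionRing R))
    ((algebraMap (FractionRing R) (AlgebraicClosure (FractionRing R))).comp
      (algebraMap R (FractionRing R)))
    (by
      rw [RingHom.coe_comp]
      exact (FaithfulSMul.algebraMap_injective (FractionRing R) _).comp
        (IsFractionRing.injective R _)) hpos' hp' fun l hl => by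
    rw [List.length_take] at hl
    rw [List.getElem_take, List.take_take, min_eq_left (by omega)]
    exact hreg' l (by omega)
  obtain ⟨k, hk⟩ := exists_cls_eq (hpos _ (List.getElem_mem hj))
  have hini := hφ.map_ne_zero_of_res_ne_zero hpos' hp' (hreg' j hj)
  have hlt : ∀ t ∈ T.take j, cls t < cls T[j] := by
    intro t ht
    obtain ⟨l, hl, rfl⟩ := List.mem_take_iff_getElem.1 ht
    exact List.pairwise_iff_getElem.1 hp l j (by omega) hj (by omega)
  have h := cls_prem hφ hpos' hk hlt hini
  exact ⟨h.trans hk.symm, by rw [ldeg_eq h, ldeg_eq hk, degreeOf_prem_eq hφ hpos' hk hlt hini]⟩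

/-! ### The list of pseudo-remainders is an ascending set. -/

theorem length_premList (T : List (MvPolynomial (Fin n) K)) :
    (premList T).length = T.length := by
  rw [premList, List.length_mapIdx]

theorem getElem_premList (T : List (MvPolynomial (Fin n) K)) {j : ℕ}
    (hj : j < (premList T).length) :
    (premList T)[j] = prem (T[j]'(by rwa [length_premList] at hj)) (T.take j) := by
  simp only [premList, List.getElem_mapIdx]

/-- Classes are inherited from `T`. The `j`-th pseudo-remainder is R-reduced with respect to `T[l]`
for `l < j`, and this passes to the `l`-th pseudo-remainder because it has the same leading variable
and leading degree. -/
theorem isAscending_premList {T : List (MvPolynomial (Fin n) K)} (hT : IsRegularSet T) :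
    IsAscending (premList T) := by
  obtain ⟨hne, hpos, hp⟩ := hT.1
  refine Or.inr ⟨⟨?_, ?_, ?_⟩, ?_⟩
  · rwa [← List.length_pos_iff, length_premList, List.length_pos_iff]
  · intro a ha
    obtain ⟨j, hj, rfl⟩ := List.getElem_of_mem ha
    rw [getElem_premList, (cls_ldeg_prem_take hT _).1]
    exact hpos _ (List.getElem_mem _)
  · refine List.pairwise_iff_getElem.2 fun l j hl hj hlj => ?_
    rw [getElem_premList, getElem_premList, (cls_ldeg_prem_take hT _).1,
      (cls_ldeg_prem_take hT _).1]
    exact List.pairwise_iff_getElem.1 hp l j _ _ hlj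
  · refine List.pairwise_iff_getElem.2 fun l j hl hj hlj => ?_
    rw [getElem_premList, getElem_premList]
    rw [length_premList] at hl hj
    have h1 := isRReduced_prem (P := T[j]) (T := T.take j)
      (fun t ht => hpos t (List.mem_of_mem_take ht)) (hp.sublist (List.take_sublist _ _)) T[l]
      (List.mem_take_iff_getElem.2 ⟨l, by omega, rfl⟩)
    obtain ⟨k, hk⟩ := exists_cls_eq (hpos _ (List.getElem_mem hl))
    obtain ⟨h2, h3⟩ := cls_ldeg_prem_take hT hl
    rw [isRReduced_iff hk] at h1
    rw [isRReduced_iff (h2.trans hk)]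
    rw [ldeg_eq hk, ldeg_eq (h2.trans hk)] at h3
    omega

/-! ### Leading monomials and Gröbner bases -/

theorem degree_plex_eq_zero {F : MvPolynomial (Fin n) K} {k : Fin n} (h : F.degreeOf k = 0) :
    (plex n).degree F k = 0 := by
  rcases eq_or_ne F 0 with rfl | hF
  · simp
  · exact Nat.le_zero.1
      ((monomial_le_degreeOf k ((plex n).degree_mem_support hF)).trans h.le)

/-- No variable above `x_k` occurs in `F`, so the order compares monomials of `F` by their exponent
of `x_k` first. -/
theorem degree_plex_eq {F : MvPolynomial (Fin n) K} {k : Fin n} (h : cls F = k + 1) :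
    (plex n).degree F k = F.degreeOf k := by
  have hF : F ≠ 0 := ne_zero_of_cls_pos (by omega)
  refine le_antisymm (monomial_le_degreeOf k ((plex n).degree_mem_support hF)) ?_
  rw [degreeOf_le_iff]
  intro m hm
  by_contra hlt
  refine absurd ((plex n).le_degree hm) (not_le.2 ((plex_lt_iff _ _).2 ⟨k, fun l hl => ?_, ?_⟩))
  · have h0 : F.degreeOf l = 0 := degreeOf_eq_zero_of_cls_le (by omega)
    have := monomial_le_degreeOf l hm
    rw [degree_plex_eq_zero h0]
    omega
  · omega

theorem cls_le_of_degree_le {F G : MvPolynomial (Fin n) K}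
    (h : (plex n).degree G ≤ (plex n).degree F) : cls G ≤ cls F := by
  by_contra hlt
  obtain ⟨k, hk⟩ := exists_cls_eq (F := G) (by omega)
  have h1 := h k
  rw [degree_plex_eq hk, degree_plex_eq_zero (degreeOf_eq_zero_of_cls_le (by omega))] at h1
  have := degreeOf_pos hk
  omega

/-- A reduction step does not change a leading monomial that is not divisible by any leading
monomial of `S`. -/
theorem ReductionStep.degree_eq {S : Set (MvPolynomial (Fin n) K)} {f h : MvPolynomial (Fin n) K}
    (hstep : ReductionStep S f h) (hf : f ≠ 0)
    (hS : ∀ p ∈ S, p ≠ 0 → ¬ (plex n).degree p ≤ (plex n).degree f) :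
    h ≠ 0 ∧ (plex n).degree h = (plex n).degree f := by
  obtain ⟨p, hp, hp0, m, hm, -, heq⟩ := hstep
  set b := f.coeff (m + (plex n).degree p) / (plex n).leadingCoeff p
  have h1 : (plex n).degree (monomial m b * p) ≺[plex n] (plex n).degree f := by
    have h2 : (plex n).degree (monomial m b * p) ≼[plex n] m + (plex n).degree p := by
      refine (plex n).degree_mul_le.trans ?_
      rw [map_add, map_add]
      exact add_le_add_left ((plex n).degree_monomial_le b) _
    -- The inequality is strict: equality would make the leading monomial of `p` divide that of `f`.
    refine lt_of_le_of_lt h2 (lt_of_le_of_ne ((plex n).le_degree (mem_support_iff.2 hm)) ?_)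
    intro h3
    exact hS p hp hp0 (((plex n).toSyn.injective h3) ▸ le_add_self)
  have h3 : h = f - monomial m b * p := by
    rw [eq_sub_iff_add_eq, add_comm]
    exact heq.symm
  have h4 : h.coeff ((plex n).degree f) = f.coeff ((plex n).degree f) := by
    rw [h3, coeff_sub, (plex n).coeff_eq_zero_of_lt h1, sub_zero]
  have h5 : h.coeff ((plex n).degree f) ≠ 0 := by
    rw [h4]
    exact (plex n).coeff_degree_ne_zero_iff.2 hf
  refine ⟨fun h0 => h5 (by rw [h0, coeff_zero]), (plex n).toSyn.injective (le_antisymm ?_ ?_)⟩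
  · rw [h3]
    exact (plex n).degree_sub_le.trans (max_le le_rfl h1.le)
  · exact (plex n).le_degree (mem_support_iff.2 h5)

/-- Otherwise the leading monomial of `f` would survive every reduction step, and `0` would never be
reached. -/
theorem exists_degree_le_of_isNormalForm_zero {S : Set (MvPolynomial (Fin n) K)}
    {f : MvPolynomial (Fin n) K} (hf : f ≠ 0) (h : IsNormalForm S f 0) :
    ∃ g ∈ S, g ≠ 0 ∧ (plex n).degree g ≤ (plex n).degree f := by
  by_contra hS
  push Not at hS
  have key : ∀ r, Relation.ReflTransGen (ReductionStep S) f r →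
      r ≠ 0 ∧ (plex n).degree r = (plex n).degree f := by
    intro r hr
    induction hr with
    | refl => exact ⟨hf, rfl⟩
    | tail _ hstep ih =>
      obtain ⟨h1, h2⟩ := hstep.degree_eq ih.1 fun p hp hp0 => by
        rw [ih.2]
        exact hS p hp hp0
      exact ⟨h1, h2.trans ih.2⟩
  exact (key 0 h.1).1 rfl

/-- If `g ≠ g'` shared a leading monomial, that monomial of `g` would be reducible by `g'` with
cofactor `1`. Hence a least element of each class is strictly least. -/
theorem IsReducedGroebnerBasis.degree_injOn {P : Set (MvPolynomial (Fin n) K)}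
    {G : Finset (MvPolynomial (Fin n) K)} (hG : IsReducedGroebnerBasis P G)
    {g g' : MvPolynomial (Fin n) K}
    (hg : g ∈ G) (hg' : g' ∈ G) (h : (plex n).degree g = (plex n).degree g') : g = g' := by
  by_contra hne
  refine (hG.2.1 g hg).2 ⟨g', ⟨hg', fun h => hne h.symm⟩, (hG.2.1 g' hg').1.ne_zero, 0, ?_⟩
  rw [zero_add, ← h, (plex n).coeff_degree_ne_zero_iff]
  exact (hG.2.1 g hg).1.ne_zero

/-- A Gröbner basis element is matched by an element of the W-characteristic set of the same class
and no larger leading monomial. -/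
theorem exists_mem_wCharSet {P : Set (MvPolynomial (Fin n) K)}
    {G : Finset (MvPolynomial (Fin n) K)} (hG : IsReducedGroebnerBasis P G)
    {C : List (MvPolynomial (Fin n) K)}
    (hC : ∀ g, g ∈ C ↔ ∃ i : ℕ, i ≤ n ∧ g ∈ truncation (G : Set (MvPolynomial (Fin n) K)) i i ∧
      ∀ g' ∈ truncation (G : Set (MvPolynomial (Fin n) K)) i i, g' ≠ g →
        (plex n).degree g ≺[plex n] (plex n).degree g')
    {g : MvPolynomial (Fin n) K} (hg : g ∈ G) :
    ∃ c ∈ C, cls c = cls g ∧ (plex n).degree c ≼[plex n] (plex n).degree g := by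
  classical
  obtain ⟨c, hc, hmin⟩ := (G.filter fun f => cls f = cls g).exists_min_image
    (fun f => (plex n).toSyn ((plex n).degree f)) ⟨g, by simp [hg]⟩
  rw [Finset.mem_filter] at hc
  refine ⟨c, (hC c).2 ⟨cls g, cls_le g, ⟨hc.1, inBand_self_iff.2 hc.2⟩, ?_⟩, hc.2,
    hmin g (by simp [hg])⟩
  rintro g' ⟨hg', hb⟩ hne
  refine lt_of_le_of_ne (hmin g' (Finset.mem_filter.2 ⟨hg', inBand_self_iff.1 hb⟩)) fun h => ?_
  exact hne (hG.degree_injOn hc.1 hg' ((plex n).toSyn.injective h)).symm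

theorem degreeOf_le_of_degree_le {F G : MvPolynomial (Fin n) K} {k : Fin n} (hF : cls F = k + 1)
    (hG : cls G = k + 1) (h : (plex n).degree F ≼[plex n] (plex n).degree G) :
    F.degreeOf k ≤ G.degreeOf k := by
  rw [← degree_plex_eq hF, ← degree_plex_eq hG]
  by_contra hlt
  refine absurd h (not_le.2 ((plex_lt_iff _ _).2 ⟨k, fun l hl => ?_, by omega⟩))
  rw [degree_plex_eq_zero (degreeOf_eq_zero_of_cls_le (by omega)),
    degree_plex_eq_zero (degreeOf_eq_zero_of_cls_le (by omega))]

/-! ### Minimality -/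

theorem IsAscending.pairwise {A : List (MvPolynomial (Fin n) K)} (hA : IsAscending A) :
    A.Pairwise fun a b => IsRReduced b a := by
  rcases hA with ⟨c, -, rfl⟩ | h
  · exact List.pairwise_singleton _ _
  · exact h.2

theorem IsAscending.ne_zero {A : List (MvPolynomial (Fin n) K)} (hA : IsAscending A)
    {a : MvPolynomial (Fin n) K} (ha : a ∈ A) : a ≠ 0 := by
  rcases hA with ⟨c, hc, rfl⟩ | h
  · rw [List.mem_singleton.1 ha]
    simpa using hc
  · exact ne_zero_of_cls_pos (h.1.2.1 a ha)

theorem SameRank.cls_eq {F G : MvPolynomial (Fin n) K} (h : SameRank F G) : cls F = cls G := by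
  unfold SameRank LowerRank at h
  omega

theorem SameRank.ldeg_eq {F G : MvPolynomial (Fin n) K} (h : SameRank F G) (h0 : 0 < cls F) :
    ldeg F = ldeg G := by
  unfold SameRank LowerRank at h
  omega

/-- If every nonzero element `b` of `S` has an element `t` of `T` of class at most `cls b` with
respect to which it is not R-reduced, then no ascending set in `S` has lower rank than a list with the
same classes and leading degrees as `T`. -/
theorem not_lowerRankList {S : Set (MvPolynomial (Fin n) K)} {T A B : List (MvPolynomial (Fin n) K)}
    (hT : IsTriangular T)
    (hS : ∀ b ∈ S, b ≠ 0 → ∃ t ∈ T, cls t ≤ cls b ∧ ¬ IsRReduced b t)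
    (hlen : A.length = T.length)
    (hA : ∀ (j : ℕ) (hj : j < A.length) (hj' : j < T.length),
      cls A[j] = cls T[j] ∧ ldeg A[j] = ldeg T[j])
    (hB : IsAscending B) (hBS : ∀ b ∈ B, b ∈ S) : ¬ LowerRankList B A := by
  -- If `B` and `A` agree in rank before `j`, the element of `T` obstructing `B[j]` has index at
  -- least `j`: for `m < j`, `B[j]` is R-reduced with respect to `B[m]`, which has the leading
  -- variable and leading degree of `T[m]`. The value `j = A.length` is allowed for the case where
  -- `B` is longer.
  have key : ∀ (j : ℕ) (hj : j < B.length) (hj' : j ≤ A.length),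
      (∀ (l : ℕ) (hl : l < j), SameRank (A[l]'(by omega)) (B[l]'(by omega))) →
      ∃ (m : ℕ) (hm : m < T.length), j ≤ m ∧ cls T[m] ≤ cls B[j] ∧ ¬ IsRReduced B[j] T[m] := by
    intro j hj hj' hsame
    obtain ⟨t, ht, hcls, hred⟩ := hS B[j] (hBS _ (List.getElem_mem hj))
      (hB.ne_zero (List.getElem_mem hj))
    obtain ⟨m, hm, rfl⟩ := List.getElem_of_mem ht
    refine ⟨m, hm, ?_, hcls, hred⟩
    by_contra hmj
    obtain ⟨hc, hd⟩ := hA m (by omega) hm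
    have hpos := hT.2.1 _ (List.getElem_mem hm)
    obtain ⟨k, hk⟩ := exists_cls_eq hpos
    have hs := hsame m (by omega)
    have hc' := hs.cls_eq
    have hd' := hs.ldeg_eq (by omega)
    have hBk : cls (B[m]'(by omega)) = k + 1 := by omega
    have hr := List.pairwise_iff_getElem.1 hB.pairwise m j (by omega) hj (by omega)
    rw [isRReduced_iff hBk] at hr
    rw [isRReduced_iff hk] at hred
    rw [hd, WRitt.ldeg_eq hk, WRitt.ldeg_eq hBk] at hd'
    omega
  rintro (⟨j, hjA, hjB, hsame, hlow⟩ | ⟨hAB, hsame⟩)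
  · obtain ⟨m, hm, hjm, hcls, hred⟩ := key j hjB hjA.le hsame
    obtain ⟨hc, hd⟩ := hA j hjA (by omega)
    -- For `m = j`, `B[j]` has at least the class of `T[j]` and, if the classes agree, at least its
    -- leading degree. For `m > j` its class is already strictly larger. Both contradict `B[j] ≺
    -- A[j]`.
    rcases hjm.eq_or_lt with rfl | hlt
    · obtain ⟨k, hk⟩ := exists_cls_eq (hT.2.1 _ (List.getElem_mem hm))
      rw [isRReduced_iff hk] at hred
      rcases hlow with hlow | ⟨h1, -, h2⟩
      · omega
      · rw [hd, WRitt.ldeg_eq hk, WRitt.ldeg_eq (h1.trans (hc.trans hk))] at h2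
        omega
    · have := List.pairwise_iff_getElem.1 hT.2.2 j m (by omega) hm hlt
      rcases hlow with hlow | ⟨h1, -, -⟩ <;> omega
  · obtain ⟨m, hm, hjm, -⟩ := key A.length hAB le_rfl hsame
    omega

end

end WRitt

/-! ### The corollary. -/

theorem mainTheorem6 {K : Type*} [Field K] {n : ℕ}
    (P : Finset (MvPolynomial (Fin n) K)) (hP : P.Nonempty) (hP0 : ∀ p ∈ P, p ≠ 0)
    (C : List (MvPolynomial (Fin n) K))
    (hC : WRitt.IsWCharSet (P : Set (MvPolynomial (Fin n) K)) C)
    (i : ℕ) (hi : i ≤ n)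
    (hreg : WRitt.IsRegularSet (WRitt.truncationList C 0 i)) :
    WRitt.IsRittCharSet
      (WRitt.truncation
        (Ideal.span (P : Set (MvPolynomial (Fin n) K)) : Set (MvPolynomial (Fin n) K)) 0 i)
      (WRitt.premList (WRitt.truncationList C 0 i)) := by
  obtain ⟨G, hG, hCmem, -⟩ := hC
  have hT : ∀ t, t ∈ WRitt.truncationList C 0 i ↔ t ∈ C ∧ WRitt.cls t ≤ i := fun t => by
    simp [WRitt.truncationList, WRitt.inBand_zero_iff]
  have hTI : ∀ t ∈ WRitt.truncationList C 0 i,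
      t ∈ Ideal.span (P : Set (MvPolynomial (Fin n) K)) := by
    intro t ht
    obtain ⟨_, -, htG, -⟩ := (hCmem t).1 ((hT t).1 ht).1
    rw [← hG.2.2]
    exact Ideal.subset_span htG.1
  refine ⟨WRitt.isAscending_premList hreg, ?_, fun B hB hBS => ?_⟩
  · intro a ha
    obtain ⟨j, hj, rfl⟩ := List.getElem_of_mem ha
    have hj' := hj
    rw [WRitt.length_premList] at hj'
    rw [WRitt.getElem_premList]
    have hmem := List.getElem_mem hj'
    refine ⟨?_, WRitt.inBand_zero_iff.2 ?_⟩
    · obtain ⟨J, -, hJ⟩ := WRitt.prem_spec (WRitt.truncationList C 0 i)[j]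
        (T := (WRitt.truncationList C 0 i).take j)
        fun t ht => hreg.1.2.1 t (List.mem_of_mem_take ht)
      have hle : Ideal.span {t | t ∈ (WRitt.truncationList C 0 i).take j}
          ≤ Ideal.span (P : Set (MvPolynomial (Fin n) K)) :=
        Ideal.span_le.2 fun t ht => hTI t (List.mem_of_mem_take ht)
      -- Both `J * C_j` and its difference from the pseudo-remainder lie in the ideal.
      exact (Submodule.sub_mem_iff_right _
        (Ideal.mul_mem_left _ J (hTI _ hmem))).1 (hle hJ)
    · rw [(WRitt.cls_ldeg_prem_take hreg hj').1]
      exact ((hT _).1 hmem).2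
  · refine WRitt.not_lowerRankList hreg.1 ?_ (WRitt.length_premList _) ?_ hB hBS
    · rintro b ⟨hbI, hbi⟩ hb0
      rw [WRitt.inBand_zero_iff] at hbi
      obtain ⟨g, hg, hg0, hdvd⟩ :=
        WRitt.exists_degree_le_of_isNormalForm_zero hb0 ((hG.1 b).1 hbI)
      have hgb := WRitt.cls_le_of_degree_le hdvd
      obtain ⟨c, hc, hcg, hdeg⟩ := WRitt.exists_mem_wCharSet hG hCmem hg
      -- The class of `c` is that of `g`, at most that of `b`, hence at most `i`, so `c` survives
      -- the truncation. Being in a triangular set, it is not constant.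
      have hcT := (hT c).2 ⟨hc, by omega⟩
      refine ⟨c, hcT, by omega, ?_⟩
      obtain ⟨k, hk⟩ := WRitt.exists_cls_eq (hreg.1.2.1 c hcT)
      have hgk := hcg.symm.trans hk
      rw [WRitt.isRReduced_iff hk, not_lt]
      calc c.degreeOf k ≤ g.degreeOf k := WRitt.degreeOf_le_of_degree_le hk hgk hdeg
        _ = (WRitt.plex n).degree g k := (WRitt.degree_plex_eq hgk).symm
        _ ≤ (WRitt.plex n).degree b k := hdvd k
        _ ≤ b.degreeOf k :=
          MvPolynomial.monomial_le_degreeOf k ((WRitt.plex n).degree_mem_support hb0)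
    · intro j hj hj'
      rw [WRitt.getElem_premList]
      exact WRitt.cls_ldeg_prem_take hreg hj'
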